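/- Let $k \ge 1$ and let $L$, $R$ be disjoint sets of $k$ parties each. In a synchronous fully-connected unauthenticated network, all $2k$ parties are pairwise connected by bidirectional channels on which the receiver of a message knows its sender; there are no signatures or other cryptographic tools, and a (deterministic) protocol proceeds in rounds. Each party holds as input a preference list, i.e. a permutation of the parties on the opposite side, and prefers every party on its list to being alone. An adversary permanently corrupts up to $t_L$ parties in $L$ and up to $t_R$ parties in $R$; corrupted (byzantine) parties deviate arbitrarily, and a party is honest if it is never corrupted. The adversary is adaptive if it may corrupt parties at any point of the execution, and static if it must choose them at the beginning. A protocol achieves byzantine stable matching (bSM) with respect to $t_L$ and $t_R$ if, for all inputs and all behaviours of such an adversary: - (Termination) every honest party outputs a party on the opposite side or nobody; - (Symmetry) for honest $u, v$, if $u$ outputs $v$, then $v$ outputs $u$; - (Stability) there are no honest $u\in L$ and $v\in R$ that strictly prefer each other to their outputs (outputting nobody counts as being alone); - (Non-competition) no two distinct honest parties output the same party. If $k = 1$, assume in addition that $t_L = 0$ or $t_R = 0$. **Theorem.** There is a protocol that achieves bSM with respect to $t_L$ and $t_R$ in the synchronous fully-connected unauthenticated network on $L\cup R$ if and only if $t_L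 < k/3$ or $t_R < k/3$. The equivalence holds against adaptive adversaries, and also against static adversaries. -/

import Mathlib

/-- The `2k` parties: `Sum.inl i` is the `i`-th party of `L`, `Sum.inr j` the `j`-th party of `R`. -/
abbrev Party (k : ℕ) : Type := Fin k ⊕ Fin k

/-- The index of a party within its own side. -/
def Party.index {k : ℕ} : Party k → Fin k := Sum.elim id id

/-- The two parties are on different sides. -/
def Party.Opposite {k : ℕ} (p q : Party k) : Prop := p.isLeft ≠ q.isLeft

/-- A preference list: a permutation of the parties on the opposite side, most preferred first.
`π a` is the index (on the opposite side) of the party at position `a` of the list. -/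
abbrev PrefList (k : ℕ) : Type := Equiv.Perm (Fin k)

/-- The holder of the list `π` strictly prefers the opposite party `q` to the outcome `d`, where
`d = none` is being alone, which is worse than every party, and `d = some w` is being matched
to the opposite party `w`. -/
def PrefList.Prefers {k : ℕ} (π : PrefList k) (q : Party k) : Option (Party k) → Prop
  | none => True
  | some w => π.symm q.index < π.symm w.index

/-- A deterministic round-based protocol for `2k` parties holding preference lists. In each round
a party sends to every other party a message or nothing (`none`), depending on its local state, and
then updates its state according to what it received from each party (the receiver knows the sender
of each message). `output p s = none` means that `p` has not produced its output in state `s`;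
`output p s = some none` means that `p` outputs nobody, and `output p s = some (some q)` that `p`
outputs `q`. -/
structure Protocol (k : ℕ) where
  Msg : Type
  State : Type
  init : Party k → PrefList k → State
  send : Party k → State → Party k → Option Msg
  recv : Party k → State → (Party k → Option Msg) → State
  output : Party k → State → Option (Option (Party k))

/-- The behaviour of an adaptive adversary: `corrupt r` is the set of parties that are corrupted when
the messages of round `r` are sent (corruption is permanent), and `msg r q p` is what the party `q`
sends to `p` in round `r` if it is corrupted by then. No restriction is put on these messages. As
properties are required for all such behaviours, these include the outcome of every strategy that
chooses corruptions and messages depending on the execution. -/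
structure Adversary (k : ℕ) (Msg : Type) where
  corrupt : ℕ → Finset (Party k)
  corrupt_mono : Monotone corrupt
  msg : ℕ → Party k → Party k → Option Msg

namespace Adversary

variable {k : ℕ} {Msg : Type}

/-- At most `tL` parties in `L` and at most `tR` parties in `R` are ever corrupted. -/
def Within (A : Adversary k Msg) (tL tR : ℕ) : Prop :=
  ∀ r, ((A.corrupt r).filter fun p => p.isLeft = true).card ≤ tL ∧
    ((A.corrupt r).filter fun p => p.isRight = true).card ≤ tR

/-- All corruptions take place at the beginning. -/
def IsStatic (A : Adversary k Msg) : Prop := ∀ r, A.corrupt r = A.corrupt 0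

/-- A party is honest if it never becomes byzantine. -/
def Honest (A : Adversary k Msg) (p : Party k) : Prop := ∀ r, p ∉ A.corrupt r

end Adversary

namespace Protocol

variable {k : ℕ}

open Classical in
/-- What `p` receives from `q` in round `r` over the network `G` when the current states are `s`. -/
noncomputable def delivered (P : Protocol k) (G : SimpleGraph (Party k))
    (A : Adversary k P.Msg) (r : ℕ) (s : Party k → P.State) (q p : Party k) : Option P.Msg :=
  if G.Adj q p then
    if q ∈ A.corrupt r then A.msg r q p else P.send q (s q) p
  else none

/-- The states at the beginning of each round, in the synchronous execution with inputs `x`. (The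
state of a party that has been corrupted has no effect on the other parties.) -/
noncomputable def state (P : Protocol k) (G : SimpleGraph (Party k)) (x : Party k → PrefList k)
    (A : Adversary k P.Msg) : ℕ → Party k → P.State
  | 0 => fun p => P.init p (x p)
  | r + 1 => fun p =>
      P.recv p (P.state G x A r p) fun q => P.delivered G A r (P.state G x A r) q p

/-- The (first, hence final) output that `p` produces in the execution is `d`. -/
def Outputs (P : Protocol k) (G : SimpleGraph (Party k)) (x : Party k → PrefList k)
    (A : Adversary k P.Msg) (p : Party k) (d : Option (Party k)) : Prop :=
  ∃ r, P.output p (P.state G x A r p) = some d ∧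
    ∀ s < r, P.output p (P.state G x A s p) = none

/-- Every honest party outputs a party on the opposite side or nobody. -/
def Termination (P : Protocol k) (G : SimpleGraph (Party k)) (x : Party k → PrefList k)
    (A : Adversary k P.Msg) : Prop :=
  ∀ p, A.Honest p → ∃ d, P.Outputs G x A p d ∧ ∀ q, d = some q → p.Opposite q

/-- If an honest party decides to match an honest party, the latter decides to match the former. -/
def Symmetry (P : Protocol k) (G : SimpleGraph (Party k)) (x : Party k → PrefList k)
    (A : Adversary k P.Msg) : Prop :=
  ∀ u v, A.Honest u → A.Honest v →
    P.Outputs G x A u (some v) → P.Outputs G x A v (some u)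

/-- No pair of honest parties on opposite sides is blocking, that is, no two of them prefer each
other to what they output. -/
def Stability (P : Protocol k) (G : SimpleGraph (Party k)) (x : Party k → PrefList k)
    (A : Adversary k P.Msg) : Prop :=
  ∀ u v, u.Opposite v → A.Honest u → A.Honest v →
    ∀ du dv, P.Outputs G x A u du → P.Outputs G x A v dv →
      ¬ ((x u).Prefers v du ∧ (x v).Prefers u dv)

/-- No two distinct honest parties output the same party. -/
def NonCompetition (P : Protocol k) (G : SimpleGraph (Party k)) (x : Party k → PrefList k)
    (A : Adversary k P.Msg) : Prop :=
  ∀ p p', p ≠ p' → A.Honest p → A.Honest p' →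
    ∀ u v, P.Outputs G x A p (some u) → P.Outputs G x A p' (some v) → u ≠ v

/-- The four properties of byzantine stable matching, in one execution. -/
def StableMatching (P : Protocol k) (G : SimpleGraph (Party k)) (x : Party k → PrefList k)
    (A : Adversary k P.Msg) : Prop :=
  P.Termination G x A ∧ P.Symmetry G x A ∧ P.Stability G x A ∧ P.NonCompetition G x A

end Protocol

/-- Byzantine stable matching is solvable in the unauthenticated synchronous network `G` when an
adaptive adversary corrupts up to `tL` parties in `L` and up to `tR` parties in `R`. -/
def BSMSolvable {k : ℕ} (G : SimpleGraph (Party k)) (tL tR : ℕ) : Prop :=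
  ∃ P : Protocol k, ∀ (x : Party k → PrefList k) (A : Adversary k P.Msg),
    A.Within tL tR → P.StableMatching G x A

/-- Byzantine stable matching is solvable in the unauthenticated synchronous network `G` when a
static adversary corrupts up to `tL` parties in `L` and up to `tR` parties in `R`. -/
def BSMSolvableStatic {k : ℕ} (G : SimpleGraph (Party k)) (tL tR : ℕ) : Prop :=
  ∃ P : Protocol k, ∀ (x : Party k → PrefList k) (A : Adversary k P.Msg),
    A.IsStatic → A.Within tL tR → P.StableMatching G x A

/-! Suppose first that fewer than a third of one side can be corrupted. That side serves as a
committee: every party announces its list, and phase king agreement within the committee settles one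
list per party. All `2k` parties apply the same update rules to the committee's messages, so
corruptions on the other side do no harm. Everyone ends with the same lists, which are the true ones
for honest parties (`exists_common_lists`), and outputs its partner in one fixed stable matching for
them.

Conversely, let `k ≤ 3 * tL` and `k ≤ 3 * tR`. The parties split into three groups, each small
enough to be corrupted as a whole (`within_copyAdversary`). Consider a fictitious network with two
copies of group 2, holding different lists, where group 0 hears one copy and group 1 the other. Each
of three attacks, corrupting one group, shows the honest parties a part of this network
(`state_copyAdversary`). With group 1 or group 0 corrupted, a pair of mutual favourites must match
(`outputs_of_favourites`); this makes a party of group 0 and one of group 1 choose the same party of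
group 2. With group 2 corrupted, these two are both honest and compete.

The attacks are static and the protocol withstands adaptive adversaries, which gives both
equivalences. -/

/-! ### Existence of stable matchings -/

/-- In a complete instance with as many parties on both sides, there is a stable perfect matching. -/
theorem exists_stable_perm {n : ℕ} (f g : Fin n → Equiv.Perm (Fin n)) :
    ∃ M : Equiv.Perm (Fin n), ∀ i j,
      ¬ ((f i).symm j < (f i).symm (M i) ∧ (g j).symm i < (g j).symm (M.symm j)) := by
  classical
  -- the pairs that deferred acceptance rejects, as a least fixed point
  let P : Set (Fin n × Fin n) → Set (Fin n × Fin n) := fun S =>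
    {p | ∀ j, (f p.1).symm j < (f p.1).symm p.2 → (p.1, j) ∈ S}
  have hP : Monotone P := fun S T h p hp j hj => h (hp j hj)
  let F : Set (Fin n × Fin n) →o Set (Fin n × Fin n) :=
    { toFun := fun S => {p | ∃ i, (i, p.2) ∈ P S ∧ (g p.2).symm i < (g p.2).symm p.1}
      monotone' := fun S T h p ⟨i, hi, hlt⟩ => ⟨i, hP h hi, hlt⟩ }
  obtain ⟨S, hS⟩ : ∃ S, F S = S := ⟨F.lfp, F.map_lfp⟩
  have memS : ∀ i j, (i, j) ∈ S ↔ ∃ i', (i', j) ∈ P S ∧ (g j).symm i' < (g j).symm i := by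
    intro i j
    conv_lhs => rw [← hS]
    rfl
  -- `P S` consists of the proposals made: `i` is rejected by all it likes better than `j`. Those
  -- outside `S` are the proposals still held.
  have uniqL : ∀ i j j', (i, j) ∈ P S → (i, j) ∉ S → (i, j') ∈ P S → (i, j') ∉ S → j = j' := by
    intro i j j' h1 h2 h3 h4
    rcases lt_trichotomy ((f i).symm j) ((f i).symm j') with h | h | h
    · exact absurd (h3 j h) h2
    · exact (f i).symm.injective h
    · exact absurd (h1 j' h) h4
  have uniqR : ∀ i i' j, (i, j) ∈ P S → (i, j) ∉ S → (i', j) ∈ P S → (i', j) ∉ S → i = i' := by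
    intro i i' j h1 h2 h3 h4
    rcases lt_trichotomy ((g j).symm i) ((g j).symm i') with h | h | h
    · exact absurd ((memS _ _).2 ⟨i, h1, h⟩) h4
    · exact (g j).symm.injective h
    · exact absurd ((memS _ _).2 ⟨i', h3, h⟩) h2
  have best : ∀ j, (∃ i, (i, j) ∈ P S) → ∃ i, (i, j) ∈ P S ∧ (i, j) ∉ S := by
    rintro j ⟨i, hi⟩
    obtain ⟨m, hm, hmin⟩ := Set.exists_min_image {i | (i, j) ∈ P S} (fun i => (g j).symm i)
      (Set.toFinite _) ⟨i, hi⟩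
    refine ⟨m, hm, fun hmS => ?_⟩
    obtain ⟨i', h1, h2⟩ := (memS _ _).1 hmS
    exact absurd h2 (not_lt.2 (hmin i' h1))
  have matched : ∀ i, ∃ j, (i, j) ∈ P S ∧ (i, j) ∉ S := by
    intro i
    by_cases h : ∃ j, (i, j) ∉ S
    · obtain ⟨m, hm, hmin⟩ := Set.exists_min_image {j | (i, j) ∉ S} (fun j => (f i).symm j)
        (Set.toFinite _) h
      refine ⟨m, fun j hj => ?_, hm⟩
      by_contra hjS
      exact absurd hj (not_lt.2 (hmin j hjS))
    -- If all reject `i`, each `j` has received a proposal and holds one. Held proposals have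
    -- distinct proposers, so all proposers occur, including `i`.
    · push Not at h
      have h' : ∀ j, ∃ i, (i, j) ∈ P S ∧ (i, j) ∉ S := by
        intro j
        obtain ⟨i', hi', -⟩ := (memS _ _).1 (h j)
        exact best j ⟨i', hi'⟩
      choose m hm hm' using h'
      have hinj : Function.Injective m := fun j j' hjj =>
        uniqL (m j) j j' (hm j) (hm' j) (hjj ▸ hm j') (hjj ▸ hm' j')
      obtain ⟨j, rfl⟩ := Finite.surjective_of_injective hinj i
      exact ⟨j, hm j, hm' j⟩
  choose m hm hm' using matched
  have hinj : Function.Injective m := fun i i' hii =>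
    uniqR i i' (m i) (hm i) (hm' i) (hii ▸ hm i') (hii ▸ hm' i')
  refine ⟨Equiv.ofBijective m (Finite.injective_iff_bijective.1 hinj), fun i j ⟨h1, h2⟩ => ?_⟩
  rw [Equiv.ofBijective_apply] at h1
  obtain ⟨i', hi', hlt⟩ := (memS i j).1 (hm i j h1)
  set M := Equiv.ofBijective m (Finite.injective_iff_bijective.1 hinj)
  have hj : m (M.symm j) = j := M.apply_symm_apply j
  have h3 := hm' (M.symm j)
  rw [hj] at h3
  exact h3 ((memS _ _).2 ⟨i', hi', hlt.trans h2⟩)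

/-- A stable matching for the lists `v`. -/
noncomputable def stablePerm {k : ℕ} (v : Party k → PrefList k) : Equiv.Perm (Fin k) :=
  (exists_stable_perm (fun i => v (Sum.inl i)) (fun j => v (Sum.inr j))).choose

theorem stablePerm_stable {k : ℕ} (v : Party k → PrefList k) (i j : Fin k) :
    ¬ ((v (Sum.inl i)).symm j < (v (Sum.inl i)).symm (stablePerm v i) ∧
      (v (Sum.inr j)).symm i < (v (Sum.inr j)).symm ((stablePerm v).symm j)) :=
  (exists_stable_perm (fun i => v (Sum.inl i)) (fun j => v (Sum.inr j))).choose_spec i j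

/-- The partner of a party in the stable matching for the lists `v`. -/
noncomputable def stablePartner {k : ℕ} (v : Party k → PrefList k) : Party k → Party k
  | Sum.inl i => Sum.inr (stablePerm v i)
  | Sum.inr j => Sum.inl ((stablePerm v).symm j)

theorem stablePartner_involutive {k : ℕ} (v : Party k → PrefList k) :
    Function.Involutive (stablePartner v) := by
  rintro (i | j) <;> simp [stablePartner]

theorem opposite_stablePartner {k : ℕ} (v : Party k → PrefList k) (p : Party k) :
    p.Opposite (stablePartner v p) := by
  rcases p with i | j <;> simp [stablePartner, Party.Opposite]

theorem stablePartner_stable {k : ℕ} (v : Party k → PrefList k) {p q : Party k}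
    (hpq : p.Opposite q) :
    ¬ ((v p).Prefers q (some (stablePartner v p)) ∧ (v q).Prefers p (some (stablePartner v q))) := by
  rcases p with i | i <;> rcases q with j | j
  · simp [Party.Opposite] at hpq
  · exact stablePerm_stable v i j
  · exact fun h => stablePerm_stable v j i h.symm
  · simp [Party.Opposite] at hpq

/-! ### Quorums -/

section Quorum

open Classical in
/-- The number of members of the committee that report the value `v`. -/
noncomputable def support {k : ℕ} {V : Type} (f : Fin k → Option V) (v : V) : ℕ :=
  (Finset.univ.filter fun q => f q = some v).card

variable {k t : ℕ} {V : Type} {H : Finset (Fin k)} {f g : Fin k → Option V} {v w : V}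

theorem exists_mem_of_lt_support (hH : Hᶜ.card ≤ t) (hv : t < support f v) :
    ∃ q ∈ H, f q = some v := by
  classical
  by_contra! h
  have : (Finset.univ.filter fun q => f q = some v) ⊆ Hᶜ := by
    intro q hq
    rw [Finset.mem_compl]
    exact fun hqH => h q hqH (Finset.mem_filter.1 hq).2
  have := Finset.card_le_card this
  unfold support at hv
  lia

theorem le_support_add (hH : Hᶜ.card ≤ t) (hv : ∀ q ∈ H, f q = some v) : k ≤ support f v + t := by
  classical
  have : H ⊆ (Finset.univ.filter fun q => f q = some v) := fun q hq => by simp [hv q hq]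
  have := Finset.card_le_card this
  have h2 := Finset.card_compl_add_card H
  rw [Fintype.card_fin] at h2
  unfold support
  lia

/-- Of at least `k - t` reports at most `t` come from outside `H`; the other `k - 2t > t` are the
same in `g`. -/
theorem lt_support_of_quorum (hH : Hᶜ.card ≤ t) (hk : 3 * t < k) (hfg : ∀ q ∈ H, f q = g q)
    (hv : k ≤ support f v + t) : t < support g v := by
  classical
  have : (Finset.univ.filter fun q => f q = some v) ⊆
      (Finset.univ.filter fun q => g q = some v) ∪ Hᶜ := by
    intro q hq
    by_cases hqH : q ∈ H
    · simp [← hfg q hqH, (Finset.mem_filter.1 hq).2]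
    · simp [hqH]
  have := (Finset.card_le_card this).trans (Finset.card_union_le _ _)
  unfold support at hv ⊢
  lia

/-- Two sets of at least `k - t` members share at least `k - 2t > t`, hence a member of `H`, where
`f` and `g` coincide. -/
theorem quorum_unique (hH : Hᶜ.card ≤ t) (hk : 3 * t < k) (hfg : ∀ q ∈ H, f q = g q)
    (hv : k ≤ support f v + t) (hw : k ≤ support g w + t) : v = w := by
  classical
  by_contra hne
  have : Disjoint (Finset.univ.filter fun q => f q = some v)
      ((Finset.univ.filter fun q => g q = some w) \ Hᶜ) := by
    rw [Finset.disjoint_left]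
    intro q hq hq'
    simp only [Finset.mem_filter, Finset.mem_sdiff, Finset.mem_compl, not_not, Finset.mem_univ,
      true_and] at hq hq'
    rw [← hfg q hq'.2, hq] at hq'
    exact hne (Option.some.inj hq'.1)
  have h1 := Finset.card_union_of_disjoint this
  have h2 := Finset.card_le_univ ((Finset.univ.filter fun q => f q = some v) ∪
    ((Finset.univ.filter fun q => g q = some w) \ Hᶜ))
  have h3 := Finset.le_card_sdiff Hᶜ (Finset.univ.filter fun q => g q = some w)
  rw [Fintype.card_fin] at h2
  unfold support at hv hw
  lia

end Quorum

/-! ### Agreement on all lists by a committee, with all parties listening -/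

/-- The state of a party in the phase king protocol, run in parallel for the lists of all parties:
the round, the current values, the proposed values, and the values that the king cannot change. -/
structure KingState (k : ℕ) where
  round : ℕ
  val : Party k → PrefList k
  prop : Party k → Option (PrefList k)
  locked : Party k → Prop

namespace KingState

variable {k : ℕ}

/-- The message that is sent to everyone. -/
def message (s : KingState k) : Party k → Option (PrefList k) :=
  if s.round % 3 = 2 then s.prop else fun i => some (s.val i)

open Classical in
/-- The update of the state when `h q` is the message of `q`. The `r`-th round serves to send lists
for `r = 0`, values for `r = 3 * j + 1`, proposals for `r = 3 * j + 2`, and the values of the `j`-th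
king for `r = 3 * j + 3`. -/
noncomputable def update (com : Fin k → Party k) (t : ℕ) (s : KingState k)
    (h : Party k → Party k → Option (PrefList k)) : KingState k where
  round := s.round + 1
  val i :=
    -- The default only concerns corrupted senders, in whose place any list will do.
    if s.round = 0 then (h i i).getD 1
    else if s.round % 3 = 2 then
      if hv : ∃ v, t < support (fun q => h (com q) i) v then hv.choose else s.val i
    else if s.round % 3 = 0 ∧ ¬ s.locked i then
      if hj : s.round / 3 - 1 < k then (h (com ⟨s.round / 3 - 1, hj⟩) i).getD 1 else s.val i
    else s.val i
  -- `prop` and `locked` are recomputed in every round, but `prop` is used only after round `3 * j +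
  -- 1` and `locked` only after round `3 * j + 2`.
  prop i :=
    if hv : ∃ v, k ≤ support (fun q => h (com q) i) v + t then some hv.choose else none
  locked i := ∃ v, k ≤ support (fun q => h (com q) i) v + t

end KingState

open Classical in
/-- The phase king protocol with committee `com`, followed by the computation of a stable matching
for the values agreed on. -/
noncomputable def kingProtocol {k : ℕ} (com : Fin k → Party k) (t : ℕ) : Protocol k where
  Msg := Party k → Option (PrefList k)
  State := KingState k
  init _ π := ⟨0, fun _ => π, fun _ => none, fun _ => False⟩
  send _ s _ := some s.message
  -- The network has no loops, so a party's own message is put in by hand; silence counts as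
  -- reporting no value.
  recv p s m := s.update com t fun q => if q = p then s.message else (m q).getD fun _ => none
  output p s := if s.round = 3 * k + 1 then some (some (stablePartner s.val p)) else none

section King

variable {k t : ℕ} {com : Fin k → Party k} {x : Party k → PrefList k}
  {A : Adversary k (kingProtocol com t).Msg}

variable (x A) in
/-- The states in the execution of the phase king protocol. -/
noncomputable def kingState (r : ℕ) (p : Party k) : KingState k :=
  (kingProtocol com t).state ⊤ x A r p

variable (x A) in
open Classical in
/-- What `p` takes as the message of `q` in round `r`. -/
noncomputable def heard (r : ℕ) (p q : Party k) : Party k → Option (PrefList k) :=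
  if q = p then (kingState x A r p).message
  else ((kingProtocol com t).delivered ⊤ A r ((kingProtocol com t).state ⊤ x A r) q p).getD
    fun _ => none

theorem kingState_succ (r : ℕ) (p : Party k) :
    kingState x A (r + 1) p = (kingState x A r p).update com t (heard x A r p) := rfl

theorem round_kingState (r : ℕ) (p : Party k) : (kingState x A r p).round = r := by
  induction r with
  | zero => rfl
  | succ r ih => rw [kingState_succ]; exact congrArg (· + 1) ih

/-- The receiver may be corrupted: its state is still updated by the protocol, which allows
agreement to be claimed for all parties. -/
theorem heard_of_honest {q : Party k} (hq : A.Honest q) (r : ℕ) (p : Party k) :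
    heard x A r p q = (kingState x A r q).message := by
  by_cases h : q = p
  · simp [heard, h]
  · simp only [heard, Protocol.delivered, SimpleGraph.top_adj, ne_eq, h, not_false_eq_true, if_true,
      if_neg (hq r)]
    rfl

theorem val_one_of_honest {i : Party k} (hi : A.Honest i) (p : Party k) :
    (kingState x A 1 p).val i = x i := by
  rw [kingState_succ]
  simp only [KingState.update, round_kingState, if_true, heard_of_honest hi]
  simp only [KingState.message, round_kingState]
  rfl

theorem message_eq_val (r : ℕ) (hr : r % 3 ≠ 2) (q i : Party k) :
    (kingState x A r q).message i = some ((kingState x A r q).val i) := by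
  simp [KingState.message, round_kingState, hr]

theorem message_eq_prop (r : ℕ) (hr : r % 3 = 2) (q i : Party k) :
    (kingState x A r q).message i = (kingState x A r q).prop i := by
  simp [KingState.message, round_kingState, hr]

variable {H : Finset (Fin k)} (hH : Hᶜ.card ≤ t) (hk : 3 * t < k) (hcom : ∀ q ∈ H, A.Honest (com q))

include hH hk hcom in
theorem prop_agree (r : ℕ) {p p' i : Party k} {v w : PrefList k}
    (hv : (kingState x A (r + 1) p).prop i = some v)
    (hw : (kingState x A (r + 1) p').prop i = some w) : v = w := by
  rw [kingState_succ] at hv hw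
  simp only [KingState.update] at hv hw
  split_ifs at hv hw with h1 h2
  have e1 := h1.choose_spec
  have e2 := h2.choose_spec
  rw [Option.some.inj hv] at e1
  rw [Option.some.inj hw] at e2
  exact quorum_unique hH hk (fun q hq => by simp only [heard_of_honest (hcom q hq)]) e1 e2

include hH hk hcom in
/-- A value supported by more than `t` proposals is adopted. -/
theorem val_of_lt_support (j : ℕ) {p i : Party k} {v : PrefList k}
    (hv : t < support (fun q => heard x A (3 * j + 2) p (com q) i) v) :
    (kingState x A (3 * j + 3) p).val i = v := by
  rw [kingState_succ (3 * j + 2)]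
  have hex : ∃ v, t < support (fun q => heard x A (3 * j + 2) p (com q) i) v := ⟨v, hv⟩
  simp only [KingState.update, round_kingState]
  rw [if_neg (by lia), if_pos (by lia), dif_pos hex]
  -- The chosen value and `v` each have an honest proposer, and honest proposals agree.
  obtain ⟨q, hq, h1⟩ := exists_mem_of_lt_support hH hex.choose_spec
  obtain ⟨q', hq', h2⟩ := exists_mem_of_lt_support hH hv
  simp only [heard_of_honest (hcom _ hq), message_eq_prop _ (show (3 * j + 2) % 3 = 2 by lia)] at h1
  simp only [heard_of_honest (hcom _ hq'), message_eq_prop _ (show (3 * j + 2) % 3 = 2 by lia)] at h2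
  exact prop_agree hH hk hcom (3 * j + 1) h1 h2

theorem locked_iff (r : ℕ) (p i : Party k) : (kingState x A (r + 1) p).locked i ↔
    ∃ v, k ≤ support (fun q => heard x A r p (com q) i) v + t := Iff.rfl

theorem val_of_locked (j : ℕ) {p i : Party k} (h : (kingState x A (3 * j + 3) p).locked i) :
    (kingState x A (3 * j + 4) p).val i = (kingState x A (3 * j + 3) p).val i := by
  rw [kingState_succ (3 * j + 3)]
  simp only [KingState.update, round_kingState]
  rw [if_neg (by lia), if_neg (by lia), if_neg (fun h' => h'.2 h)]

include hH hk hcom in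
/-- Once all parties have the same value, they keep it. -/
theorem val_persistent (j : ℕ) {i : Party k} {v : PrefList k}
    (hv : ∀ p, (kingState x A (3 * j + 1) p).val i = v) (p : Party k) :
    (kingState x A (3 * j + 4) p).val i = v := by
  have hprop : ∀ p, (kingState x A (3 * j + 2) p).prop i = some v := by
    intro p
    have hq : k ≤ support (fun q => heard x A (3 * j + 1) p (com q) i) v + t :=
      le_support_add hH fun q hq => by
        simp only [heard_of_honest (hcom q hq), message_eq_val _ (show (3 * j + 1) % 3 ≠ 2 by lia),
          hv]
    have hex : ∃ v, k ≤ support (fun q => heard x A (3 * j + 1) p (com q) i) v + t := ⟨v, hq⟩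
    rw [kingState_succ (3 * j + 1)]
    simp only [KingState.update]
    rw [dif_pos hex]
    exact congrArg some (quorum_unique hH hk (fun _ _ => rfl) hex.choose_spec hq)
  have hq : k ≤ support (fun q => heard x A (3 * j + 2) p (com q) i) v + t :=
    le_support_add hH fun q hq => by
      simp only [heard_of_honest (hcom q hq), message_eq_prop _ (show (3 * j + 2) % 3 = 2 by lia),
        hprop]
  rw [val_of_locked j ⟨v, hq⟩]
  exact val_of_lt_support hH hk hcom j (lt_support_of_quorum hH hk (fun _ _ => rfl) hq)

include hH hk hcom in
/-- An honest king makes all parties agree. -/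
theorem exists_val_of_king (j : Fin k) (hj : A.Honest (com j)) (i : Party k) :
    ∃ v, ∀ p, (kingState x A (3 * j + 4) p).val i = v := by
  refine ⟨(kingState x A (3 * j + 3) (com j)).val i, fun p => ?_⟩
  by_cases h : (kingState x A (3 * j + 3) p).locked i
  -- A quorum for `v` seen by `p` gives more than `t` proposals of `v` at the king, who has
  -- therefore adopted `v` too.
  · obtain ⟨v, hv⟩ := (locked_iff _ _ _).1 h
    rw [val_of_locked _ h,
      val_of_lt_support hH hk hcom j (lt_support_of_quorum hH hk (fun _ _ => rfl) hv)]
    refine (val_of_lt_support hH hk hcom j (lt_support_of_quorum hH hk (fun q hq => ?_) hv)).symm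
    simp only [heard_of_honest (hcom q hq)]
  · have hlt : (3 * (j : ℕ) + 3) / 3 - 1 < k := by lia
    have hidx : (⟨(3 * (j : ℕ) + 3) / 3 - 1, hlt⟩ : Fin k) = j := Fin.ext (by simp)
    rw [kingState_succ (3 * j + 3)]
    simp only [KingState.update, round_kingState]
    rw [if_neg (by lia), if_neg (by lia), if_pos ⟨by rw [round_kingState]; lia, h⟩, dif_pos hlt, hidx,
      heard_of_honest hj, message_eq_val _ (by lia)]
    rfl

include hH hk hcom in
theorem val_persistent_le (i : Party k) (v : PrefList k) {j n : ℕ} (hjn : j ≤ n)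
    (hv : ∀ p, (kingState x A (3 * j + 1) p).val i = v) (p : Party k) :
    (kingState x A (3 * n + 1) p).val i = v := by
  induction n, hjn using Nat.le_induction generalizing p with
  | base => exact hv p
  | succ n _ ih => exact val_persistent hH hk hcom n ih p

include hH hk hcom in
/-- In the end all parties have the same lists, which are the inputs of the honest parties. -/
theorem exists_common_lists : ∃ v : Party k → PrefList k,
    (∀ i, A.Honest i → v i = x i) ∧ ∀ p, (kingState x A (3 * k + 1) p).val = v := by
  obtain ⟨j, hj⟩ : H.Nonempty := by
    rw [Finset.nonempty_iff_ne_empty]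
    rintro rfl
    rw [Finset.compl_empty, Finset.card_univ, Fintype.card_fin] at hH
    lia
  have := fun i => exists_val_of_king (x := x) hH hk hcom j (hcom j hj) i
  choose v hv using this
  -- The phase of king `j` ends in round `3 * j + 4 = 3 * (j + 1) + 1`, the start of phase `j + 1`.
  have hfin : ∀ i p, (kingState x A (3 * k + 1) p).val i = v i := fun i p =>
    val_persistent_le hH hk hcom i (v i) (Nat.succ_le_of_lt j.2) (hv i) p
  refine ⟨v, fun i hi => ?_, fun p => funext fun i => hfin i p⟩
  rw [← hfin i i]
  exact val_persistent_le hH hk hcom i (x i) (Nat.zero_le k) (val_one_of_honest hi) i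

include hH hk hcom in
theorem kingProtocol_stableMatching : (kingProtocol com t).StableMatching ⊤ x A := by
  obtain ⟨v, hvx, hv⟩ := exists_common_lists (x := x) hH hk hcom
  have hout : ∀ r p, (kingProtocol com t).output p ((kingProtocol com t).state ⊤ x A r p) =
      if r = 3 * k + 1 then some (some (stablePartner (kingState x A r p).val p)) else none := by
    intro r p
    have h := round_kingState (x := x) (A := A) r p
    simp only [kingState] at h ⊢
    simp only [kingProtocol] at h ⊢
    simp only [h]
  have houtputs : ∀ p d, (kingProtocol com t).Outputs ⊤ x A p d ↔ d = some (stablePartner v p) := by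
    intro p d
    constructor
    · rintro ⟨r, hr, -⟩
      rw [hout] at hr
      split_ifs at hr with h
      rw [← Option.some.inj hr, h, hv]
    · rintro rfl
      refine ⟨3 * k + 1, by rw [hout, if_pos rfl, hv], fun s hs => ?_⟩
      rw [hout, if_neg hs.ne]
  refine ⟨fun p _ => ⟨_, (houtputs p _).2 rfl, ?_⟩, ?_, ?_, ?_⟩
  · intro q hq
    rw [← Option.some.inj hq]
    exact opposite_stablePartner v p
  · intro u w _ _ h
    rw [houtputs] at h ⊢
    rw [Option.some.inj h, stablePartner_involutive v u]
  · intro u w huw hu hw du dw h1 h2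
    rw [(houtputs _ _).1 h1, (houtputs _ _).1 h2, ← hvx u hu, ← hvx w hw]
    exact stablePartner_stable v huw
  · intro p p' hne _ _ u w h1 h2 huw
    rw [houtputs] at h1 h2
    apply hne
    apply (stablePartner_involutive v).injective
    rw [← Option.some.inj h1, ← Option.some.inj h2, huw]

end King

/-- From some round on, every party that is not yet corrupted is honest. -/
theorem Adversary.exists_honest_of_notMem {k : ℕ} {Msg : Type} (A : Adversary k Msg) :
    ∃ r, ∀ p, p ∉ A.corrupt r → A.Honest p := by
  classical
  have : ∀ p, ∃ r, ∀ s, p ∈ A.corrupt s → p ∈ A.corrupt r := by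
    intro p
    by_cases h : ∃ r, p ∈ A.corrupt r
    · exact h.imp fun r hr _ _ => hr
    · push Not at h
      exact ⟨0, fun s hs => absurd hs (h s)⟩
  choose r hr using this
  exact ⟨Finset.univ.sup r, fun p hp s hs =>
    hp (A.corrupt_mono (Finset.le_sup (Finset.mem_univ p)) (hr p s hs))⟩

/-- If less than a third of the committee can be corrupted, then byzantine stable matching is
solvable. -/
theorem bsmSolvable_of_committee {k tL tR t : ℕ} (com : Fin k → Party k) (hk : 3 * t < k)
    (hcom : ∀ {Msg : Type} (A : Adversary k Msg), A.Within tL tR → ∀ r (S : Finset (Fin k)),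
      (∀ q ∈ S, com q ∈ A.corrupt r) → S.card ≤ t) :
    BSMSolvable (⊤ : SimpleGraph (Party k)) tL tR := by
  classical
  refine ⟨kingProtocol com t, fun x A hA => ?_⟩
  obtain ⟨r, hr⟩ := A.exists_honest_of_notMem
  refine kingProtocol_stableMatching (H := Finset.univ.filter fun q => com q ∉ A.corrupt r)
    (hcom A hA r _ fun q hq => ?_) hk fun q hq => hr _ (Finset.mem_filter.1 hq).2
  simpa using hq

theorem bsmSolvable_of_left {k tL : ℕ} (tR : ℕ) (hk : 3 * tL < k) :
    BSMSolvable (⊤ : SimpleGraph (Party k)) tL tR := by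
  refine bsmSolvable_of_committee Sum.inl hk fun A hA r S hS => ?_
  rw [← Finset.card_map (Function.Embedding.inl : Fin k ↪ Party k)]
  refine (Finset.card_le_card fun p hp => ?_).trans (hA r).1
  obtain ⟨q, hq, rfl⟩ := Finset.mem_map.1 hp
  exact Finset.mem_filter.2 ⟨hS q hq, rfl⟩

theorem bsmSolvable_of_right {k tR : ℕ} (tL : ℕ) (hk : 3 * tR < k) :
    BSMSolvable (⊤ : SimpleGraph (Party k)) tL tR := by
  refine bsmSolvable_of_committee Sum.inr hk fun A hA r S hS => ?_
  rw [← Finset.card_map (Function.Embedding.inr : Fin k ↪ Party k)]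
  refine (Finset.card_le_card fun p hp => ?_).trans (hA r).2
  obtain ⟨q, hq, rfl⟩ := Finset.mem_map.1 hp
  exact Finset.mem_filter.2 ⟨hS q hq, rfl⟩

/-! ### Impossibility -/

section Impossibility

variable {k : ℕ}

/-- The parties are divided into the groups `0`, `1`, `2`. -/
def grp : Party k → ℕ
  | Sum.inl i => i % 3
  | Sum.inr j => (j + 2) % 3

/-- The copy of `q` that the copy `e` of `p` is connected to. Only group `2` has two copies in use:
copy `true` is connected to group `0`, and copy `false` to group `1`. -/
def link (p : Party k) (e : Bool) (q : Party k) : Bool :=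
  if grp q = 2 then (if grp p = 0 then true else if grp p = 2 then e else false) else false

/-- The states in the network of copies. -/
def copyState (P : Protocol k) (x : Party k → Bool → PrefList k) :
    ℕ → Party k → Bool → P.State
  | 0 => fun p e => P.init p (x p e)
  | r + 1 => fun p e => P.recv p (copyState P x r p e) fun q =>
      if q = p then none else P.send q (copyState P x r q (link p e q)) p

/-- The adversary that corrupts group `c`, and makes the other parties see the network of copies in
which `p` is the copy `σ p`. -/
def copyAdversary (P : Protocol k) (x : Party k → Bool → PrefList k) (c : ℕ)
    (σ : Party k → Bool) : Adversary k P.Msg where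
  corrupt _ := Finset.univ.filter fun p => grp p = c
  corrupt_mono _ _ _ := le_rfl
  msg r q p := P.send q (copyState P x r q (link p (σ p) q)) p

theorem honest_copyAdversary (P : Protocol k) (x : Party k → Bool → PrefList k) (c : ℕ)
    (σ : Party k → Bool) (p : Party k) : (copyAdversary P x c σ).Honest p ↔ grp p ≠ c := by
  simp [Adversary.Honest, copyAdversary]

/-- Within a residue class modulo 3, an index is determined by its quotient by 3, which is less than
`t`. -/
theorem card_le_of_mod_eq {t : ℕ} (ht : k ≤ 3 * t) (a c : ℕ) (S : Finset (Fin k))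
    (hS : ∀ i ∈ S, ((i : ℕ) + a) % 3 = c) : S.card ≤ t := by
  rw [← Finset.card_range t]
  refine Finset.card_le_card_of_injOn (fun i : Fin k => (i : ℕ) / 3) (fun i _ => ?_) ?_
  · simp only [Finset.coe_range, Set.mem_Iio]
    have := i.2
    lia
  · intro i hi j hj hij
    have h1 := hS i hi
    have h2 := hS j hj
    simp only at hij
    exact Fin.ext (by lia)

theorem within_copyAdversary (P : Protocol k) (x : Party k → Bool → PrefList k) (c : ℕ)
    (σ : Party k → Bool) {tL tR : ℕ} (hL : k ≤ 3 * tL) (hR : k ≤ 3 * tR) :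
    (copyAdversary P x c σ).Within tL tR := by
  classical
  intro r
  constructor
  · refine le_trans (Finset.card_le_card fun p hp => ?_)
      ((Finset.card_map (Function.Embedding.inl : Fin k ↪ Party k)).trans_le
        (card_le_of_mod_eq hL 0 c (Finset.univ.filter fun i : Fin k => ((i : ℕ) + 0) % 3 = c)
          fun i hi => (Finset.mem_filter.1 hi).2))
    obtain ⟨h, hside⟩ := Finset.mem_filter.1 hp
    have hc := (Finset.mem_filter.1 h).2
    rcases p with i | i
    · exact Finset.mem_map_of_mem _ (Finset.mem_filter.2 ⟨Finset.mem_univ i, hc⟩)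
    · simp at hside
  · refine le_trans (Finset.card_le_card fun p hp => ?_)
      ((Finset.card_map (Function.Embedding.inr : Fin k ↪ Party k)).trans_le
        (card_le_of_mod_eq hR 2 c (Finset.univ.filter fun i : Fin k => ((i : ℕ) + 2) % 3 = c)
          fun i hi => (Finset.mem_filter.1 hi).2))
    obtain ⟨h, hside⟩ := Finset.mem_filter.1 hp
    have hc := (Finset.mem_filter.1 h).2
    rcases p with i | i
    · simp at hside
    · exact Finset.mem_map_of_mem _ (Finset.mem_filter.2 ⟨Finset.mem_univ i, hc⟩)

/-- By `hσ`, honest parties are linked to each other's selected copies, and the corrupted group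
sends what the linked copies of it would send. -/
theorem state_copyAdversary (P : Protocol k) (x : Party k → Bool → PrefList k) (c : ℕ)
    (σ : Party k → Bool)
    (hσ : ∀ p q, grp p ≠ c → grp q ≠ c → p ≠ q → link p (σ p) q = σ q) (r : ℕ) (p : Party k)
    (hp : grp p ≠ c) :
    P.state ⊤ (fun p => x p (σ p)) (copyAdversary P x c σ) r p = copyState P x r p (σ p) := by
  induction r generalizing p with
  | zero => rfl
  | succ r ih =>
    simp only [Protocol.state, copyState, ih p hp]
    congr 1
    funext q
    by_cases hqp : q = p
    · simp [Protocol.delivered, hqp]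
    · by_cases hq : grp q = c
      · simp [Protocol.delivered, hqp, hq, copyAdversary]
      · have : q ∉ (copyAdversary P x c σ).corrupt r := by simp [copyAdversary, hq]
        simp only [Protocol.delivered, SimpleGraph.top_adj, ne_eq, hqp, not_false_eq_true, if_true,
          if_neg this, if_false, ih q hq]
        rw [hσ p q hp hq (Ne.symm hqp)]

/-- The copy `e` of `p` outputs `d`. -/
def CopyOutputs (P : Protocol k) (x : Party k → Bool → PrefList k) (p : Party k) (e : Bool)
    (d : Option (Party k)) : Prop :=
  ∃ r, P.output p (copyState P x r p e) = some d ∧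
    ∀ s < r, P.output p (copyState P x s p e) = none

theorem outputs_copyAdversary (P : Protocol k) (x : Party k → Bool → PrefList k) (c : ℕ)
    (σ : Party k → Bool)
    (hσ : ∀ p q, grp p ≠ c → grp q ≠ c → p ≠ q → link p (σ p) q = σ q) (p : Party k)
    (hp : grp p ≠ c) (d : Option (Party k)) :
    P.Outputs ⊤ (fun p => x p (σ p)) (copyAdversary P x c σ) p d ↔ CopyOutputs P x p (σ p) d := by
  simp only [Protocol.Outputs, CopyOutputs, state_copyAdversary P x c σ hσ _ p hp]

theorem stableMatching_copyAdversary {P : Protocol k} {tL tR : ℕ}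
    (hP : ∀ (x : Party k → PrefList k) (A : Adversary k P.Msg),
      A.IsStatic → A.Within tL tR → P.StableMatching ⊤ x A)
    (hL : k ≤ 3 * tL) (hR : k ≤ 3 * tR) (x : Party k → Bool → PrefList k) (c : ℕ)
    (σ : Party k → Bool) :
    P.StableMatching ⊤ (fun p => x p (σ p)) (copyAdversary P x c σ) :=
  hP _ _ (fun _ => rfl) (within_copyAdversary P x c σ hL hR)

end Impossibility

/-- Two honest parties that are each other's favourites are matched. -/
theorem Protocol.StableMatching.outputs_of_favourites {k : ℕ} {P : Protocol k}
    {G : SimpleGraph (Party k)} {x : Party k → PrefList k} {A : Adversary k P.Msg}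
    (h : P.StableMatching G x A) {u v : Party k} (huv : u.Opposite v) (hu : A.Honest u)
    (hv : A.Honest v) (hxu : ((x u).symm v.index : ℕ) = 0) (hxv : ((x v).symm u.index : ℕ) = 0) :
    P.Outputs G x A u (some v) := by
  obtain ⟨hterm, hsymm, hstab, -⟩ := h
  have prefers : ∀ p q : Party k, p.Opposite q → ((x p).symm q.index : ℕ) = 0 →
      ∀ d, d ≠ some q → (∀ w, d = some w → p.Opposite w) → (x p).Prefers q d := by
    intro p q hpq hxp d hd hw
    rcases d with _ | w
    · trivial
    · have hpw := hw w rfl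
      have hne : q.index ≠ w.index := by
        rcases p with p | p <;> rcases q with q | q <;> rcases w with w | w <;>
          simp_all [Party.Opposite, Party.index, eq_comm]
      have := fun h => hne ((x p).symm.injective h)
      change (x p).symm q.index < (x p).symm w.index
      rw [Fin.lt_def, hxp]
      exact Nat.pos_of_ne_zero fun h0 => this (Fin.ext (hxp.trans h0.symm))
  obtain ⟨du, hdu, hdu'⟩ := hterm u hu
  obtain ⟨dv, hdv, hdv'⟩ := hterm v hv
  by_cases h1 : du = some v
  · exact h1 ▸ hdu
  by_cases h2 : dv = some u
  · exact hsymm v u hv hu (h2 ▸ hdv)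
  exact absurd ⟨prefers u v huv hxu du h1 hdu', prefers v u huv.symm hxv dv h2 hdv'⟩
    (hstab u v huv hu hv du dv hdu hdv)

theorem not_bsmSolvableStatic {k tL tR : ℕ} (hk : 2 ≤ k) (hL : k ≤ 3 * tL) (hR : k ≤ 3 * tR) :
    ¬ BSMSolvableStatic (⊤ : SimpleGraph (Party k)) tL tR := by
  rintro ⟨P, hP⟩
  let i₀ : Fin k := ⟨0, by lia⟩
  let i₁ : Fin k := ⟨1, by lia⟩
  have hi : i₀ ≠ i₁ := by simp [i₀, i₁]
  -- copy `true` of `inr i₀` and `inl i₀`, and copy `false` of `inr i₀` and `inl i₁` are favourites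
  let x : Party k → Bool → PrefList k := fun p e =>
    if p.isRight = true ∧ e = false then Equiv.swap i₀ i₁ else 1
  -- The shift by 2 in `grp` puts the two rivals and the party they compete for into three different
  -- groups.
  have ha : grp (Sum.inl i₀ : Party k) = 0 := rfl
  have hb : grp (Sum.inl i₁ : Party k) = 1 := rfl
  have hc : grp (Sum.inr i₀ : Party k) = 2 := rfl
  have hgrp : ∀ p : Party k, grp p < 3 := by
    rintro (i | i) <;> exact Nat.mod_lt _ (by lia)
  have hσ₁ : ∀ p q : Party k, grp p ≠ 1 → grp q ≠ 1 → p ≠ q →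
      link p (decide (grp p = 2)) q = decide (grp q = 2) := by
    intro p q hp hq _
    have h1 := hgrp p
    by_cases h2 : grp p = 0
    · simp [link, h2]
    · simp [link, show grp p = 2 by lia]
  have hσ₀ : ∀ p q : Party k, grp p ≠ 0 → grp q ≠ 0 → p ≠ q → link p false q = false := by
    intro p q hp _ _
    simp [link, hp]
  have hσ₂ : ∀ p q : Party k, grp p ≠ 2 → grp q ≠ 2 → p ≠ q → link p false q = false := by
    intro p q _ hq _
    simp [link, hq]
  -- Group 1 is corrupted; group 0 and copy `true` of group 2 are honest.
  have out₁ : CopyOutputs P x (Sum.inl i₀) false (some (Sum.inr i₀)) := by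
    have h := (stableMatching_copyAdversary hP hL hR x 1
      fun p => decide (grp p = 2)).outputs_of_favourites (u := Sum.inl i₀) (v := Sum.inr i₀)
      (by simp [Party.Opposite]) ((honest_copyAdversary ..).2 (by lia))
      ((honest_copyAdversary ..).2 (by lia)) (by simp [x, Party.index, i₀]; rfl)
      (by simp [x, Party.index, hc, i₀]; rfl)
    rw [outputs_copyAdversary P x 1 _ hσ₁ _ (by lia)] at h
    exact h
  -- Group 0 is corrupted; group 1 and copy `false` of group 2 are honest.
  have out₂ : CopyOutputs P x (Sum.inl i₁) false (some (Sum.inr i₀)) := by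
    have h := (stableMatching_copyAdversary hP hL hR x 0
      fun _ => false).outputs_of_favourites (u := Sum.inl i₁) (v := Sum.inr i₀)
      (by simp [Party.Opposite]) ((honest_copyAdversary ..).2 (by lia))
      ((honest_copyAdversary ..).2 (by lia)) (by simp [x, Party.index, i₀]; rfl)
      (by simp [x, Party.index]; rfl)
    rw [outputs_copyAdversary P x 0 _ hσ₀ _ (by lia)] at h
    exact h
  -- Group 2 is corrupted and plays copy `true` towards group 0 and copy `false` towards group 1.
  have h := (stableMatching_copyAdversary hP hL hR x 2 fun _ => false).2.2.2
    (Sum.inl i₀) (Sum.inl i₁) (by simpa using hi) ((honest_copyAdversary ..).2 (by lia))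
    ((honest_copyAdversary ..).2 (by lia)) (Sum.inr i₀) (Sum.inr i₀)
  rw [outputs_copyAdversary P x 2 _ hσ₂ _ (by lia),
    outputs_copyAdversary P x 2 _ hσ₂ _ (by lia)] at h
  exact h out₁ out₂ rfl

theorem BSMSolvable.static {k : ℕ} {G : SimpleGraph (Party k)} {tL tR : ℕ}
    (h : BSMSolvable G tL tR) : BSMSolvableStatic G tL tR :=
  h.imp fun _ hP x A _ hA => hP x A hA

theorem mainTheorem1 (k tL tR : ℕ) (hk : 1 ≤ k) (hk1 : k = 1 → tL = 0 ∨ tR = 0) :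
    (BSMSolvable (⊤ : SimpleGraph (Party k)) tL tR ↔
      (tL : ℝ) < (k : ℝ) / 3 ∨ (tR : ℝ) < (k : ℝ) / 3) ∧
    (BSMSolvableStatic (⊤ : SimpleGraph (Party k)) tL tR ↔
      (tL : ℝ) < (k : ℝ) / 3 ∨ (tR : ℝ) < (k : ℝ) / 3) := by
  have hcast : ∀ t : ℕ, (t : ℝ) < (k : ℝ) / 3 ↔ 3 * t < k := by
    intro t
    rw [lt_div_iff₀ (by norm_num), mul_comm]
    exact_mod_cast Iff.rfl
  rw [hcast, hcast]
  have possible : 3 * tL < k ∨ 3 * tR < k → BSMSolvable (⊤ : SimpleGraph (Party k)) tL tR :=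
    fun h => h.elim (bsmSolvable_of_left tR) (bsmSolvable_of_right tL)
  have impossible : BSMSolvableStatic (⊤ : SimpleGraph (Party k)) tL tR →
      3 * tL < k ∨ 3 * tR < k := by
    intro h
    by_contra! hlt
    -- The case `k = 1` is excluded since `tL = 0` or `tR = 0` would contradict `hlt`; two rivals on
    -- one side need `2 ≤ k`.
    exact not_bsmSolvableStatic (by lia) hlt.1 hlt.2 h
  exact ⟨⟨fun h => impossible h.static, possible⟩, ⟨impossible, fun h => (possible h).static⟩⟩
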